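/- Let $E,A\in\mathbb{C}^{n\times n}$, $B\in\mathbb{C}^{n\times m}$, $C\in\mathbb{C}^{m\times n}$. The system $E\dot x=Ax+Bu,\ y=Cx$ is called port-Hamiltonian (with structure matrix $Q$) if there are $Q,J,R\in\mathbb{C}^{n\times n}$ and $G,P\in\mathbb{C}^{n\times m}$ with $$A=(J-R)Q,\quad B=G-P,\quad C=(G+P)^*Q,\quad Q^*E=E^*Q\ge 0,\quad Q^*JQ=-(Q^*JQ)^*,\quad Q^*RQ\ge 0,\quad Q^*P=0 .$$ A pair $(E,A)$ is regular if $\det(sE-A)\neq 0$ for some $s\in\mathbb{C}$, impulse-free if $\deg\det(sE-A)=\operatorname{rank}E$, and asymptotically stable if every $s\in\mathbb{C}$ with $\det(sE-A)=0$ satisfies $\operatorname{Re}s<0$. Suppose that the system $E\dot x=Ax+Bu,\ y=Cx$ is port-Hamiltonian. Then the following are equivalent. (a) For every integer $r$ with $$\operatorname{rank}\begin{bmatrix}E&B\end{bmatrix}-\operatorname{rank}B\le r\le\operatorname{rank}\begin{bmatrix}E&B\end{bmatrix}$$ there exist $K,F\in\mathbb{C}^{m\times m}$ such that the pair $(E+BFC,\,A-BKC)$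 is regular, impulse-free and asymptotically stable, $\operatorname{rank}(E+BFC)=r$, and the closed-loop system $(E+BFC)\dot x=(A-BKC)x+Bv,\ y=Cx$ is port-Hamiltonian. (b) $$\operatorname{rank}\begin{bmatrix}E&0&0\\A&E&B\\C&0&0\end{bmatrix}=n+\operatorname{rank}\begin{bmatrix}E&B\end{bmatrix},$$ and for all $s\in\mathbb{C}$ with $\operatorname{Re}s=0$, $$\operatorname{rank}\begin{bmatrix}sE-A&B\end{bmatrix}=\operatorname{rank}\begin{bmatrix}sE-A\\C\end{bmatrix}=n .$$ Moreover, for every structure matrix $Q$ of the given system, the same equivalence holds when in (a) the closed-loop system is required to be port-Hamiltonian with this same structure matrix $Q$. -/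

import Mathlib

open scoped Matrix ComplexOrder

namespace PHDescriptor

/-- The matrix pair `(E, A)` is regular: `det (s E - A) ≠ 0` for some complex `s`. -/
def IsRegular {n : ℕ} (E A : Matrix (Fin n) (Fin n) ℂ) : Prop :=
  ∃ s : ℂ, (s • E - A).det ≠ 0

/-- The characteristic polynomial `det (s E - A)` of the pair, as a polynomial in `s`. -/
noncomputable def charPoly {n : ℕ} (E A : Matrix (Fin n) (Fin n) ℂ) : Polynomial ℂ :=
  ((Polynomial.X : Polynomial ℂ) • E.map Polynomial.C - A.map Polynomial.C).det

/-- The matrix pair `(E, A)` is impulse-free: `deg (det (s E - A)) = rank E`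
(the degree of the zero polynomial is `⊥`, which is never equal to a rank). -/
def IsImpulseFree {n : ℕ} (E A : Matrix (Fin n) (Fin n) ℂ) : Prop :=
  (charPoly E A).degree = (E.rank : WithBot ℕ)

/-- The matrix pair `(E, A)` is asymptotically stable: every finite root of `det (s E - A)`
lies in the open left half plane. -/
def IsAsymptoticallyStable {n : ℕ} (E A : Matrix (Fin n) (Fin n) ℂ) : Prop :=
  ∀ s : ℂ, (s • E - A).det = 0 → s.re < 0

/-- The descriptor system `E x' = A x + B u`, `y = C x` is port-Hamiltonian with structure
matrix `Q`. -/
def IsPortHamiltonianWith {n m : ℕ} (Q E A : Matrix (Fin n) (Fin n) ℂ)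
    (B : Matrix (Fin n) (Fin m) ℂ) (C : Matrix (Fin m) (Fin n) ℂ) : Prop :=
  ∃ (J R : Matrix (Fin n) (Fin n) ℂ) (G P : Matrix (Fin n) (Fin m) ℂ),
    A = (J - R) * Q ∧ B = G - P ∧ C = (G + P)ᴴ * Q ∧
    Qᴴ * E = Eᴴ * Q ∧ (Qᴴ * E).PosSemidef ∧
    Qᴴ * J * Q = -(Qᴴ * J * Q)ᴴ ∧
    (Qᴴ * R * Q).PosSemidef ∧
    Qᴴ * P = 0

/-- The descriptor system `E x' = A x + B u`, `y = C x` is a port-Hamiltonian descriptor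
system: its coefficients admit a port-Hamiltonian representation for some `Q`. -/
def IsPortHamiltonian {n m : ℕ} (E A : Matrix (Fin n) (Fin n) ℂ)
    (B : Matrix (Fin n) (Fin m) ℂ) (C : Matrix (Fin m) (Fin n) ℂ) : Prop :=
  ∃ Q : Matrix (Fin n) (Fin n) ℂ, IsPortHamiltonianWith Q E A B C

/-- `rank [E 0 0; A E B; C 0 0] = n + rank [E B]`. -/
def BlockRankCondition {n m : ℕ} (E A : Matrix (Fin n) (Fin n) ℂ)
    (B : Matrix (Fin n) (Fin m) ℂ) (C : Matrix (Fin m) (Fin n) ℂ) : Prop :=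
  (Matrix.fromRows
      (Matrix.fromCols E
        (Matrix.fromCols (0 : Matrix (Fin n) (Fin n) ℂ) (0 : Matrix (Fin n) (Fin m) ℂ)))
      (Matrix.fromRows
        (Matrix.fromCols A (Matrix.fromCols E B))
        (Matrix.fromCols C
          (Matrix.fromCols (0 : Matrix (Fin m) (Fin n) ℂ) (0 : Matrix (Fin m) (Fin m) ℂ))))).rank
    = n + (Matrix.fromCols E B).rank

/-- `rank [sE - A, B] = rank [sE - A; C] = n` for all `s` on the imaginary axis. -/
def ImaginaryAxisRankCondition {n m : ℕ} (E A : Matrix (Fin n) (Fin n) ℂ)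
    (B : Matrix (Fin n) (Fin m) ℂ) (C : Matrix (Fin m) (Fin n) ℂ) : Prop :=
  ∀ s : ℂ, s.re = 0 →
    (Matrix.fromCols (s • E - A) B).rank = n ∧ (Matrix.fromRows (s • E - A) C).rank = n

end PHDescriptor

open PHDescriptor

/-! Necessity needs only the largest `r`. Then `E + B F C` and `[E B]` have the same range, and
impulse-freeness yields the block rank condition. The closed-loop pencil factors through `[sE - A,
B]` and `[sE - A; C]`, so its invertibility on the imaginary axis gives the other rank conditions.

For sufficiency, `Qᴴ P = 0` gives `C = Bᴴ Q`, and the axis condition at `s = 0` makes `Q`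
invertible. Hence `Qᴴ (E + B F C) = Qᴴ E + (Qᴴ B) F (Qᴴ B)ᴴ`, and choosing `F` becomes a rank
assignment problem for positive semidefinite matrices. With `K = 1` the dissipation gains `‖C x‖²`.
A vector violating stability or impulse-freeness dissipates nothing, so `C x = 0`; the feedback does
not act on it, and the open-loop conditions force `x = 0`. -/

/-! ### Impulse-freeness as a kernel condition -/

open Matrix Polynomial in
theorem Matrix.natDegree_det_le_sum_and_coeff {ι R : Type*} [Fintype ι] [DecidableEq ι] [CommRing R]
    (M : Matrix ι ι R[X]) (d : ι → ℕ) (h : ∀ i j, (M i j).natDegree ≤ d j) :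
    M.det.natDegree ≤ ∑ j, d j ∧
      M.det.coeff (∑ j, d j) = (Matrix.of fun i j => (M i j).coeff (d j)).det := by
  have key : ∀ (s : Finset ι) (f : ι → R[X]), (∀ j, (f j).natDegree ≤ d j) →
      (∏ j ∈ s, f j).natDegree ≤ ∑ j ∈ s, d j ∧
        (∏ j ∈ s, f j).coeff (∑ j ∈ s, d j) = ∏ j ∈ s, (f j).coeff (d j) := by
    intro s f hf
    induction s using Finset.induction_on with
    | empty => simp
    | insert a s ha ih =>
      rw [Finset.prod_insert ha, Finset.sum_insert ha, Finset.prod_insert ha]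
      exact ⟨natDegree_mul_le_of_le (hf a) ih.1,
        by rw [coeff_mul_add_eq_of_natDegree_le (hf a) ih.1, ih.2]⟩
  constructor
  · rw [det_apply]
    refine natDegree_sum_le_of_forall_le _ _ fun σ _ => ?_
    exact (natDegree_smul_le _ _).trans (key _ (fun j => M (σ j) j) fun j => h _ j).1
  · rw [det_apply, det_apply, finsetSum_coeff]
    refine Finset.sum_congr rfl fun σ _ => ?_
    rw [coeff_smul, (key _ (fun j => M (σ j) j) fun j => h _ j).2]
    rfl

namespace PHDescriptor

open Polynomial

theorem charPoly_mul_mul {n : ℕ} (L E A U : Matrix (Fin n) (Fin n) ℂ) :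
    charPoly (L * E * U) (L * A * U) = C L.det * charPoly E A * C U.det := by
  have h : ∀ M : Matrix (Fin n) (Fin n) ℂ, (M.map C).det = C M.det := fun M =>
    (RingHom.map_det C M).symm
  unfold charPoly
  rw [← h, ← h, ← Matrix.det_mul, ← Matrix.det_mul]
  congr 1
  simp only [Matrix.map_mul, Matrix.mul_sub, Matrix.sub_mul, Matrix.mul_smul, Matrix.smul_mul]

/-- Only the columns with `d j ≠ 0` depend on `s`, so the degree is at most the rank, and
impulse-freeness says that the coefficient at that degree is nonzero. -/
theorem isImpulseFree_diagonal_iff {n : ℕ} (d : Fin n → ℂ) (A : Matrix (Fin n) (Fin n) ℂ) :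
    IsImpulseFree (Matrix.diagonal d) A ↔
      ∀ x y, (Matrix.diagonal d).mulVec x = 0 → A.mulVec x = (Matrix.diagonal d).mulVec y →
        x = 0 := by
  classical
  set k : Fin n → ℕ := fun j => if d j = 0 then 0 else 1 with hk
  have hentry : ∀ i j, ((X : ℂ[X]) • (Matrix.diagonal d).map C - A.map C) i j =
      X * C (Matrix.diagonal d i j) - C (A i j) := fun _ _ => rfl
  have hzero : ∀ i j, d j = 0 → Matrix.diagonal d i j = 0 := by
    intro i j hj
    by_cases hij : i = j
    · subst hij; simpa using hj
    · simp [hij]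
  obtain ⟨hdeg, hcoeff⟩ := Matrix.natDegree_det_le_sum_and_coeff
    ((X : ℂ[X]) • (Matrix.diagonal d).map C - A.map C) k (by
      intro i j
      rw [hentry]
      by_cases hj : d j = 0
      · simp [hzero i j hj, hk, hj]
      · simp only [hk, hj, if_false]
        compute_degree)
  change (charPoly _ A).natDegree ≤ _ at hdeg
  change (charPoly _ A).coeff _ = _ at hcoeff
  have hrank : (Matrix.diagonal d).rank = ∑ j, k j := by
    rw [Matrix.rank_diagonal, Fintype.card_subtype, Finset.card_filter]
    refine Finset.sum_congr rfl fun j _ => ?_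
    by_cases hj : d j = 0 <;> simp [hk, hj]
  have hlead : IsImpulseFree (Matrix.diagonal d) A ↔
      (charPoly (Matrix.diagonal d) A).coeff (∑ j, k j) ≠ 0 := by
    unfold IsImpulseFree
    rw [hrank]
    constructor
    · intro h
      rw [← natDegree_eq_of_degree_eq_some h]
      exact leadingCoeff_ne_zero.2 fun h0 => by
        rw [h0, degree_zero] at h
        exact WithBot.bot_ne_coe h
    · intro h
      have h0 : charPoly (Matrix.diagonal d) A ≠ 0 := fun h0 => h (by simp [h0])
      rw [degree_eq_natDegree h0, le_antisymm hdeg (le_natDegree_of_ne_zero h)]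
  rw [hlead, hcoeff, not_iff_comm]
  -- Column `j` of `M` is that of `diagonal d` if `d j ≠ 0`, and that of `-A` otherwise.
  set M := Matrix.of fun i j => ((X : ℂ[X]) • (Matrix.diagonal d).map C - A.map C) i j |>.coeff (k j)
    with hM
  have hMv : ∀ v : Fin n → ℂ, M.mulVec v = (Matrix.diagonal d).mulVec v -
      A.mulVec (fun j => if d j = 0 then v j else 0) := by
    intro v
    ext i
    simp only [Matrix.mulVec, dotProduct, Pi.sub_apply]
    rw [← Finset.sum_sub_distrib]
    refine Finset.sum_congr rfl fun j _ => ?_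
    by_cases hj : d j = 0
    · rw [hM, Matrix.of_apply, hentry]
      simp [hk, hj, hzero i j hj]
    · rw [hM, Matrix.of_apply, hentry]
      simp [hk, hj, coeff_C]
  rw [← Matrix.exists_mulVec_eq_zero_iff]
  constructor
  · intro h
    push Not at h
    obtain ⟨x, y, hx, hxy, hx0⟩ := h
    have hx' : ∀ j, d j ≠ 0 → x j = 0 := fun j hj => by
      have := congrFun hx j
      rw [Matrix.mulVec_diagonal] at this
      simpa [hj] using this
    -- A kernel vector of `M` carries `x` on the zeros of `d` and `y` elsewhere.
    refine ⟨fun j => if d j = 0 then x j else y j, fun h0 => hx0 ?_, ?_⟩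
    · ext j
      by_cases hj : d j = 0
      · simpa [hj] using congrFun h0 j
      · exact hx' j hj
    · have h1 : (fun j => if d j = 0 then (if d j = 0 then x j else y j) else 0) = x := by
        ext j
        by_cases hj : d j = 0 <;> simp [hj, hx']
      rw [hMv, h1, hxy, sub_eq_zero]
      ext j
      rw [Matrix.mulVec_diagonal, Matrix.mulVec_diagonal]
      by_cases hj : d j = 0 <;> simp [hj]
  · rintro ⟨v, hv0, hv⟩ h
    rw [hMv, sub_eq_zero] at hv
    have hx := h (fun j => if d j = 0 then v j else 0) v (by
      ext j
      rw [Matrix.mulVec_diagonal]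
      by_cases hj : d j = 0 <;> simp [hj]) hv.symm
    rw [hx, Matrix.mulVec_zero] at hv
    refine hv0 (funext fun j => ?_)
    have h1 := congrFun hx j
    have h2 := congrFun hv j
    rw [Matrix.mulVec_diagonal] at h2
    by_cases hj : d j = 0
    · simpa [hj] using h1
    · simpa [hj] using h2

theorem isImpulseFree_mul_mul_iff {n : ℕ} {L E A U : Matrix (Fin n) (Fin n) ℂ}
    (hL : L.det ≠ 0) (hU : U.det ≠ 0) :
    IsImpulseFree (L * E * U) (L * A * U) ↔ IsImpulseFree E A := by
  unfold IsImpulseFree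
  rw [charPoly_mul_mul, degree_mul, degree_mul, degree_C hL, degree_C hU, zero_add, add_zero,
    Matrix.rank_mul_eq_left_of_det_ne_zero _ _ hU, Matrix.rank_mul_eq_right_of_det_ne_zero _ _ hL]

/-- Both sides are invariant under equivalence of pencils, and transvections diagonalize `E`. The
right side excludes chains of length two at infinity. -/
theorem isImpulseFree_iff {n : ℕ} (E A : Matrix (Fin n) (Fin n) ℂ) :
    IsImpulseFree E A ↔ ∀ x y, E.mulVec x = 0 → A.mulVec x = E.mulVec y → x = 0 := by
  obtain ⟨L, U, d, h⟩ := Matrix.Pivot.exists_list_transvec_mul_mul_list_transvec_eq_diagonal E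
  set P := (L.map Matrix.TransvectionStruct.toMatrix).prod
  set V := (U.map Matrix.TransvectionStruct.toMatrix).prod
  have hP : P.det = 1 := Matrix.TransvectionStruct.det_toMatrix_prod L
  have hV : V.det = 1 := Matrix.TransvectionStruct.det_toMatrix_prod U
  rw [← isImpulseFree_mul_mul_iff (L := P) (U := V) (by simp [hP]) (by simp [hV]), h,
    isImpulseFree_diagonal_iff, ← h]
  have hVu : IsUnit V.det := by simp [hV]
  have hPu : IsUnit P := (Matrix.isUnit_iff_isUnit_det _).2 (by simp [hP])
  have hPinj := Matrix.mulVec_injective_iff_isUnit.2 hPu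
  constructor
  · intro H x y hx hxy
    have e : ∀ z, V.mulVec (V⁻¹.mulVec z) = z := fun z => by
      rw [Matrix.mulVec_mulVec, Matrix.mul_nonsing_inv _ hVu, Matrix.one_mulVec]
    have := H (V⁻¹.mulVec x) (V⁻¹.mulVec y)
      (by simp only [← Matrix.mulVec_mulVec, e, hx, Matrix.mulVec_zero])
      (by simp only [← Matrix.mulVec_mulVec, e, hxy])
    rw [← e x, this, Matrix.mulVec_zero]
  · intro H x y hx hxy
    simp only [← Matrix.mulVec_mulVec] at hx hxy
    have := H (V.mulVec x) (V.mulVec y) (hPinj (by simpa using hx)) (hPinj hxy)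
    exact Matrix.mulVec_injective_iff_isUnit.2 ((Matrix.isUnit_iff_isUnit_det _).2 hVu)
      (by simpa using this)

end PHDescriptor

/-! ### Rank criteria and rank assignment by feedback -/

namespace Matrix

theorem rank_eq_of_mulVec_eq_zero_iff {K l m n : Type*} [Field K] [Fintype n]
    {M : Matrix l n K} {N : Matrix m n K} (h : ∀ x, M *ᵥ x = 0 ↔ N *ᵥ x = 0) :
    M.rank = N.rank := by
  have hker : LinearMap.ker M.mulVecLin = LinearMap.ker N.mulVecLin := by
    ext x
    simpa using h x
  have h1 := M.mulVecLin.finrank_range_add_finrank_ker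
  have h2 := N.mulVecLin.finrank_range_add_finrank_ker
  rw [hker] at h1
  unfold rank
  omega

theorem rank_eq_card_iff_mulVec {K m n : Type*} [Field K] [Fintype n] (M : Matrix m n K) :
    M.rank = Fintype.card n ↔ ∀ x, M *ᵥ x = 0 → x = 0 := by
  have h1 := M.mulVecLin.finrank_range_add_finrank_ker
  rw [Module.finrank_fintype_fun_eq_card] at h1
  have h2 : (∀ x, M *ᵥ x = 0 → x = 0) ↔ LinearMap.ker M.mulVecLin = ⊥ := by
    rw [LinearMap.ker_eq_bot']
    rfl
  rw [h2, ← Submodule.finrank_eq_zero]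
  unfold rank
  omega

theorem range_mulVecLin_fromCols {K l m n : Type*} [Field K] [Fintype m] [Fintype n]
    (M : Matrix l m K) (N : Matrix l n K) :
    LinearMap.range (fromCols M N).mulVecLin =
      LinearMap.range M.mulVecLin ⊔ LinearMap.range N.mulVecLin := by
  ext y
  simp only [Submodule.mem_sup, LinearMap.mem_range, mulVecLin_apply]
  constructor
  · rintro ⟨x, rfl⟩
    exact ⟨_, ⟨x ∘ Sum.inl, rfl⟩, _, ⟨x ∘ Sum.inr, rfl⟩, (fromCols_mulVec M N x).symm⟩
  · rintro ⟨_, ⟨u, rfl⟩, _, ⟨v, rfl⟩, rfl⟩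
    exact ⟨Sum.elim u v, fromCols_mulVec_sumElim M N u v⟩

/-- By the dimension formula, equality means that `M` is injective and its range meets that of `N`
trivially. -/
theorem rank_fromCols_eq_card_add_iff {K l m n : Type*} [Field K] [Fintype l] [Fintype m]
    [Fintype n] (M : Matrix l m K) (N : Matrix l n K) :
    (fromCols M N).rank = Fintype.card m + N.rank ↔
      ∀ x y, M *ᵥ x + N *ᵥ y = 0 → x = 0 := by
  have h1 := Submodule.finrank_sup_add_finrank_inf_eq
    (LinearMap.range M.mulVecLin) (LinearMap.range N.mulVecLin)
  rw [← range_mulVecLin_fromCols] at h1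
  change (fromCols M N).rank + _ = M.rank + N.rank at h1
  have h2 := M.rank_le_card_width
  have h3 : (fromCols M N).rank = Fintype.card m + N.rank ↔ M.rank = Fintype.card m ∧
      Module.finrank K ↥(LinearMap.range M.mulVecLin ⊓ LinearMap.range N.mulVecLin) = 0 := by
    omega
  rw [h3, rank_eq_card_iff_mulVec, Submodule.finrank_eq_zero, Submodule.eq_bot_iff]
  constructor
  · rintro ⟨hM, hinf⟩ x y hxy
    refine hM x (hinf _ ⟨⟨x, rfl⟩, -y, ?_⟩)
    rw [mulVecLin_apply, mulVec_neg]
    exact (eq_neg_of_add_eq_zero_left hxy).symm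
  · intro h
    refine ⟨fun x hx => h x 0 (by simp [hx]), ?_⟩
    rintro _ ⟨⟨x, rfl⟩, y, hy⟩
    rw [mulVecLin_apply, mulVecLin_apply] at hy
    have := h x (-y) (by rw [mulVec_neg, hy, add_neg_cancel])
    rw [mulVecLin_apply, this, mulVec_zero]

theorem rank_fromCols_add_mul_mul_le {K l m n : Type*} [Field K] [Fintype l] [Fintype m] [Fintype n]
    (E : Matrix l n K) (B : Matrix l m K) (F : Matrix m n K) :
    (fromCols (E + B * F) B).rank ≤ (fromCols E B).rank := by
  classical
  have h : fromCols (E + B * F) B = fromCols E B *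
      (fromBlocks 1 0 F 1 : Matrix (n ⊕ m) (n ⊕ m) K) := by
    rw [fromCols_mul_fromBlocks]
    simp
  rw [h]
  exact rank_mul_le_left _ _

open scoped ComplexOrder

theorem PosSemidef.mulVec_eq_zero_of_re {n : Type*} [Fintype n] {M : Matrix n n ℂ}
    (hM : M.PosSemidef) {x : n → ℂ} (hx : (star x ⬝ᵥ M *ᵥ x).re = 0) : M *ᵥ x = 0 := by
  refine (hM.dotProduct_mulVec_zero_iff x).1 (Complex.ext hx ?_)
  exact (Complex.nonneg_iff.1 (hM.dotProduct_mulVec_nonneg x)).2.symm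

/-- Subtracting `v vᴴ / (uᴴ M u)` with `v = M u ≠ 0` from a positive semidefinite matrix keeps it
positive semidefinite and lowers its rank by one. -/
theorem PosSemidef.exists_sub_smul_vecMulVec {n : Type*} [Fintype n]
    {M : Matrix n n ℂ} (hM : M.PosSemidef) (u : n → ℂ) (hu : M *ᵥ u ≠ 0) :
    ∃ c : ℂ, (M - c • vecMulVec (M *ᵥ u) (star (M *ᵥ u))).PosSemidef ∧
      (M - c • vecMulVec (M *ᵥ u) (star (M *ᵥ u))).rank + 1 = M.rank := by
  classical
  set v := M *ᵥ u with hv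
  set a := star u ⬝ᵥ v with ha
  have ha0 : a ≠ 0 := fun h => hu ((hM.dotProduct_mulVec_zero_iff u).1 h)
  have hstar_v : star v = star u ᵥ* M := by
    rw [hv, star_mulVec, hM.isHermitian.eq]
  have hvu : star v ⬝ᵥ u = a := by
    rw [hstar_v, ← dotProduct_mulVec]
  have haa : star a = a := (star_dotProduct v u).symm.trans hvu
  have hmul : ∀ x, (M - a⁻¹ • vecMulVec v (star v)) *ᵥ x = M *ᵥ x - (a⁻¹ * (star v ⬝ᵥ x)) • v := by
    intro x
    rw [sub_mulVec, smul_mulVec, vecMulVec_mulVec, op_smul_eq_smul, smul_smul]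
  refine ⟨a⁻¹, ?_, ?_⟩
  -- The difference is the congruence of `M` by the projection `1 - a⁻¹ u vᴴ`.
  · have h := hM.conjTranspose_mul_mul_same (1 - a⁻¹ • vecMulVec u (star v))
    convert h using 1
    have h1 : M * vecMulVec u (star v) = vecMulVec v (star v) := by rw [mul_vecMulVec]
    have h2 : vecMulVec v (star u) * M = vecMulVec v (star v) := by
      rw [vecMulVec_mul, hstar_v]
    have h3 : vecMulVec v (star v) * vecMulVec u (star v) = a • vecMulVec v (star v) := by
      rw [vecMulVec_mul_vecMulVec, vecMulVec_smul, hvu]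
    rw [conjTranspose_sub, conjTranspose_one, conjTranspose_smul, conjTranspose_vecMulVec, star_star,
      star_inv₀, haa, Matrix.sub_mul, Matrix.one_mul, smul_mul, h2, Matrix.mul_sub, Matrix.mul_one,
      Matrix.mul_smul, Matrix.sub_mul, h1, smul_mul, h3, smul_smul, inv_mul_cancel₀ ha0, one_smul, sub_self,
      smul_zero, sub_zero]
  · set N := M - a⁻¹ • vecMulVec v (star v) with hN
    -- The rank drops by at most one because `v` restores the range, and by at least one because `u`
    -- joins the kernel.
    have hle : M.rank ≤ N.rank + 1 := by
      have h1 : LinearMap.range M.mulVecLin ≤ LinearMap.range N.mulVecLin ⊔ Submodule.span ℂ {v} := by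
        rintro _ ⟨x, rfl⟩
        refine Submodule.mem_sup.2 ⟨N *ᵥ x, ⟨x, rfl⟩, (a⁻¹ * (star v ⬝ᵥ x)) • v,
          Submodule.smul_mem _ _ (Submodule.mem_span_singleton_self v), ?_⟩
        rw [hmul, sub_add_cancel, mulVecLin_apply]
      have h2 := Submodule.finrank_mono h1
      have h3 := Submodule.finrank_add_le_finrank_add_finrank
        (LinearMap.range N.mulVecLin) (Submodule.span ℂ {v})
      rw [finrank_span_singleton hu] at h3
      exact h2.trans h3
    have hlt : LinearMap.ker M.mulVecLin < LinearMap.ker N.mulVecLin := by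
      refine lt_of_le_of_ne (fun x hx => ?_) fun h => hu ?_
      · rw [LinearMap.mem_ker, mulVecLin_apply] at hx ⊢
        rw [hmul, hx, hstar_v, ← dotProduct_mulVec, hx, dotProduct_zero, mul_zero, zero_smul,
          sub_zero]
      · have : u ∈ LinearMap.ker N.mulVecLin := by
          rw [LinearMap.mem_ker, mulVecLin_apply, hmul, hvu, inv_mul_cancel₀ ha0, one_smul,
            ← hv, sub_self]
        rw [← h] at this
        exact this
    have h1 := Submodule.finrank_lt_finrank_of_lt hlt
    have h2 := M.mulVecLin.finrank_range_add_finrank_ker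
    have h3 := N.mulVecLin.finrank_range_add_finrank_ker
    unfold rank at hle ⊢
    omega

/-- A sum of positive semidefinite forms vanishes only where both do, so the kernel is that of `[E
B]ᴴ`. -/
theorem rank_add_mul_conjTranspose_self {m n : Type*} [Fintype m] [Fintype n]
    {E : Matrix n n ℂ} (hE : E.PosSemidef) (B : Matrix n m ℂ) :
    (E + B * Bᴴ).rank = (fromCols E B).rank := by
  rw [← rank_conjTranspose (fromCols E B)]
  refine rank_eq_of_mulVec_eq_zero_iff fun x => ?_
  have hB := posSemidef_self_mul_conjTranspose B
  rw [conjTranspose_fromCols_eq_fromRows_conjTranspose, fromRows_mulVec, hE.isHermitian.eq]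
  constructor
  · intro h
    have h0 : (star x ⬝ᵥ E *ᵥ x).re + (star x ⬝ᵥ (B * Bᴴ) *ᵥ x).re = 0 := by
      rw [← Complex.add_re, ← dotProduct_add, ← add_mulVec, h, dotProduct_zero, Complex.zero_re]
    have h1 : 0 ≤ (star x ⬝ᵥ E *ᵥ x).re := hE.re_dotProduct_nonneg x
    have h2 : 0 ≤ (star x ⬝ᵥ (B * Bᴴ) *ᵥ x).re := hB.re_dotProduct_nonneg x
    have h3 := hE.mulVec_eq_zero_of_re (x := x) (by linarith)
    have h4 := hB.mulVec_eq_zero_of_re (x := x) (by linarith)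
    rw [self_mul_conjTranspose_mulVec_eq_zero] at h4
    rw [h3, h4]
    exact Sum.elim_zero_zero
  · intro h
    have h1 : E *ᵥ x = 0 := funext fun i => congrFun h (Sum.inl i)
    have h2 : Bᴴ *ᵥ x = 0 := funext fun i => congrFun h (Sum.inr i)
    rw [add_mulVec, h1, ← mulVec_mulVec, h2, mulVec_zero, add_zero]

/-- Feedback `F` assigning every rank between `rank [E B] - rank B` and `rank [E B]` to
`E + B F Bᴴ` while keeping it positive semidefinite. -/
theorem PosSemidef.exists_add_mul_mul_conjTranspose_rank {m n : Type*} [Fintype m] [Fintype n]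
    {E : Matrix n n ℂ} (hE : E.PosSemidef) (B : Matrix n m ℂ) (k : ℕ) (hk : k ≤ B.rank) :
    ∃ F : Matrix m m ℂ, (E + B * F * Bᴴ).PosSemidef ∧
      (E + B * F * Bᴴ).rank + k = (fromCols E B).rank := by
  classical
  induction k with
  | zero =>
    refine ⟨1, ?_, ?_⟩
    · rw [Matrix.mul_one]
      exact hE.add (posSemidef_self_mul_conjTranspose B)
    · rw [Matrix.mul_one, add_zero, rank_add_mul_conjTranspose_self hE]
  | succ k ih =>
    obtain ⟨F, hF, hrank⟩ := ih (by omega)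
    have hle := rank_fromCols_add_mul_mul_le E B (F * Bᴴ)
    rw [← Matrix.mul_assoc] at hle
    set E' := E + B * F * Bᴴ with hE'
    -- A trivial intersection would give `rank E' + rank B ≤ rank [E B] = rank E' + k`, against `k <
    -- rank B`.
    have hinf : LinearMap.range E'.mulVecLin ⊓ LinearMap.range B.mulVecLin ≠ ⊥ := by
      intro h
      have h1 := Submodule.finrank_sup_add_finrank_inf_eq
        (LinearMap.range E'.mulVecLin) (LinearMap.range B.mulVecLin)
      rw [← range_mulVecLin_fromCols, h, finrank_bot] at h1
      change (fromCols E' B).rank + 0 = E'.rank + B.rank at h1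
      omega
    obtain ⟨v, ⟨⟨u, hu⟩, w, hw⟩, hv0⟩ := Submodule.exists_mem_ne_zero_of_ne_bot hinf
    rw [mulVecLin_apply] at hu hw
    obtain ⟨c, hc, hcr⟩ := hF.exists_sub_smul_vecMulVec u (by rwa [hu])
    -- Since `E' u = B w`, the rank-one correction has the form `B (c w wᴴ) Bᴴ` and is itself a
    -- feedback.
    have heq : E + B * (F - c • vecMulVec w (star w)) * Bᴴ =
        E' - c • vecMulVec (E' *ᵥ u) (star (E' *ᵥ u)) := by
      rw [hu, ← hw, star_mulVec, ← vecMulVec_mul, ← mul_vecMulVec, hE', Matrix.mul_sub,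
        Matrix.sub_mul, Matrix.mul_smul, smul_mul, add_sub_assoc]
    exact ⟨F - c • vecMulVec w (star w), heq ▸ hc, by rw [heq]; omega⟩

theorem re_star_dotProduct_mulVec_eq_zero_of_skew {n : Type*} [Fintype n] {T : Matrix n n ℂ}
    (hT : T = -Tᴴ) (x : n → ℂ) : (star x ⬝ᵥ T *ᵥ x).re = 0 := by
  have h : star (star x ⬝ᵥ T *ᵥ x) = -(star x ⬝ᵥ T *ᵥ x) := by
    conv_rhs => rw [hT]
    rw [← star_dotProduct, star_mulVec, neg_mulVec, dotProduct_neg, neg_neg, ← dotProduct_mulVec]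
  have := congrArg Complex.re h
  simp only [Complex.star_def, Complex.conj_re, Complex.neg_re] at this
  linarith

end Matrix

/-! ### Necessity of the rank conditions -/

namespace PHDescriptor

variable {n m : ℕ} {Q E A : Matrix (Fin n) (Fin n) ℂ} {B : Matrix (Fin n) (Fin m) ℂ}
  {C : Matrix (Fin m) (Fin n) ℂ}

open Matrix

theorem blockRankCondition_iff :
    BlockRankCondition E A B C ↔
      ∀ x y z, E *ᵥ x = 0 → C *ᵥ x = 0 → A *ᵥ x + (E *ᵥ y + B *ᵥ z) = 0 → x = 0 := by
  -- `M` is the first block column and `N` the remaining ones.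
  set M : Matrix (Fin n ⊕ (Fin n ⊕ Fin m)) (Fin n) ℂ := fromRows E (fromRows A C) with hM
  set N : Matrix (Fin n ⊕ (Fin n ⊕ Fin m)) (Fin n ⊕ Fin m) ℂ :=
    fromRows 0 (fromRows (fromCols E B) 0) with hN
  have hN_rank : N.rank = (fromCols E B).rank := by
    refine rank_eq_of_mulVec_eq_zero_iff fun x => ?_
    rw [hN, fromRows_mulVec, fromRows_mulVec, zero_mulVec, zero_mulVec]
    constructor
    · exact fun h => funext fun i => congrFun h (Sum.inr (Sum.inl i))
    · intro h
      rw [h, Sum.elim_zero_zero, Sum.elim_zero_zero]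
  have hblock : fromRows (fromCols E
        (fromCols (0 : Matrix (Fin n) (Fin n) ℂ) (0 : Matrix (Fin n) (Fin m) ℂ)))
      (fromRows (fromCols A (fromCols E B))
        (fromCols C (fromCols (0 : Matrix (Fin m) (Fin n) ℂ) (0 : Matrix (Fin m) (Fin m) ℂ)))) =
      fromCols M N := by
    ext i j
    rcases i with i | i | i <;> rcases j with j | j | j <;> rfl
  have h := rank_fromCols_eq_card_add_iff M N
  rw [Fintype.card_fin, hN_rank] at h
  unfold BlockRankCondition
  rw [hblock, h]
  have key : ∀ x w, M *ᵥ x + N *ᵥ w = 0 ↔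
      E *ᵥ x = 0 ∧ A *ᵥ x + fromCols E B *ᵥ w = 0 ∧ C *ᵥ x = 0 := by
    intro x w
    rw [hM, hN, fromRows_mulVec, fromRows_mulVec, fromRows_mulVec, fromRows_mulVec, zero_mulVec,
      zero_mulVec, ← Sum.elim_add_add, ← Sum.elim_add_add, add_zero, add_zero, ← Sum.elim_zero_zero,
      Sum.elim_eq_iff, ← Sum.elim_zero_zero, Sum.elim_eq_iff]
  constructor
  · intro H x y z hE hC hA
    exact H x (Sum.elim y z) ((key _ _).2 ⟨hE, by rwa [fromCols_mulVec_sumElim], hC⟩)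
  · intro H x w hw
    obtain ⟨hE, hA, hC⟩ := (key _ _).1 hw
    exact H x _ _ hE hC (by rwa [fromCols_mulVec] at hA)

theorem blockRankCondition_of_feedback (F K : Matrix (Fin m) (Fin m) ℂ)
    (hrank : (E + B * F * C).rank = (fromCols E B).rank)
    (himp : IsImpulseFree (E + B * F * C) (A - B * K * C)) : BlockRankCondition E A B C := by
  rw [blockRankCondition_iff]
  intro x y z hE hC hA
  rw [isImpulseFree_iff] at himp
  have hBC : ∀ (G : Matrix (Fin m) (Fin m) ℂ) (v : Fin n → ℂ),
      (B * G * C) *ᵥ v = B *ᵥ (G *ᵥ (C *ᵥ v)) := by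
    intro G v
    rw [mulVec_mulVec, mulVec_mulVec, Matrix.mul_assoc]
  have hle : LinearMap.range (E + B * F * C).mulVecLin ≤ LinearMap.range (fromCols E B).mulVecLin := by
    rw [range_mulVecLin_fromCols]
    rintro _ ⟨v, rfl⟩
    rw [mulVecLin_apply, add_mulVec, hBC]
    exact Submodule.add_mem_sup ⟨v, rfl⟩ ⟨_, rfl⟩
  have heq := Submodule.eq_of_le_of_finrank_eq hle hrank
  have hmem : A *ᵥ x ∈ LinearMap.range (E + B * F * C).mulVecLin := by
    rw [heq, range_mulVecLin_fromCols, eq_neg_of_add_eq_zero_left hA]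
    exact Submodule.neg_mem _ (Submodule.add_mem_sup ⟨y, rfl⟩ ⟨z, rfl⟩)
  obtain ⟨w, hw⟩ := hmem
  refine himp x w ?_ ?_
  · rw [add_mulVec, hBC, hC, hE, mulVec_zero, mulVec_zero, add_zero]
  · rw [sub_mulVec, hBC, hC, mulVec_zero, mulVec_zero, sub_zero]
    exact hw.symm

theorem imaginaryAxisRankCondition_of_feedback (F K : Matrix (Fin m) (Fin m) ℂ)
    (hstab : IsAsymptoticallyStable (E + B * F * C) (A - B * K * C)) :
    ImaginaryAxisRankCondition E A B C := by
  intro s hs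
  have hdet : (s • (E + B * F * C) - (A - B * K * C)).det ≠ 0 := fun h => by
    have := hstab s h
    linarith
  have hr := rank_of_isUnit _ ((isUnit_iff_isUnit_det _).2 (isUnit_iff_ne_zero.2 hdet))
  rw [Fintype.card_fin] at hr
  constructor
  · refine le_antisymm ((rank_le_card_height _).trans_eq (Fintype.card_fin n)) ?_
    have h : s • (E + B * F * C) - (A - B * K * C) =
        fromCols (s • E - A) B * fromRows (1 : Matrix (Fin n) (Fin n) ℂ) ((s • F + K) * C) := by
      rw [fromCols_mul_fromRows]
      simp only [Matrix.mul_one, Matrix.add_mul, Matrix.mul_add, Matrix.smul_mul, Matrix.mul_smul,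
        Matrix.mul_assoc, smul_add]
      abel
    rw [h] at hr
    exact hr.symm.le.trans (rank_mul_le_left _ _)
  · refine le_antisymm ((rank_le_card_width _).trans_eq (Fintype.card_fin n)) ?_
    have h : s • (E + B * F * C) - (A - B * K * C) =
        fromCols (1 : Matrix (Fin n) (Fin n) ℂ) (B * (s • F + K)) * fromRows (s • E - A) C := by
      rw [fromCols_mul_fromRows]
      simp only [Matrix.one_mul, Matrix.add_mul, Matrix.mul_add, Matrix.smul_mul, Matrix.mul_smul,
        smul_add]
      abel
    rw [h] at hr
    exact hr.symm.le.trans (rank_mul_le_right _ _)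

/-! ### Sufficiency: closing the loop with `K = 1` -/

theorem ImaginaryAxisRankCondition.eq_zero (h : ImaginaryAxisRankCondition E A B C) {s : ℂ}
    (hs : s.re = 0) {x : Fin n → ℂ} (hx : (s • E - A) *ᵥ x = 0) (hC : C *ᵥ x = 0) : x = 0 := by
  have h1 := (h s hs).2.trans (Fintype.card_fin n).symm
  rw [rank_eq_card_iff_mulVec] at h1
  refine h1 x ?_
  rw [fromRows_mulVec, hx, hC, Sum.elim_zero_zero]

theorem IsPortHamiltonianWith.output_eq (h : IsPortHamiltonianWith Q E A B C) : C = Bᴴ * Q := by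
  obtain ⟨J, R, G, P, -, rfl, rfl, -, -, -, -, hP⟩ := h
  have hP' : Pᴴ * Q = 0 := by
    rw [← conjTranspose_conjTranspose Q, ← conjTranspose_mul, hP, conjTranspose_zero]
  rw [conjTranspose_add, conjTranspose_sub, Matrix.add_mul, Matrix.sub_mul, hP', add_zero, sub_zero]

theorem IsPortHamiltonianWith.det_ne_zero (h : IsPortHamiltonianWith Q E A B C)
    (him : ImaginaryAxisRankCondition E A B C) : Q.det ≠ 0 := by
  intro hdet
  obtain ⟨x, hx0, hx⟩ := exists_mulVec_eq_zero_iff.2 hdet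
  have hC := h.output_eq
  obtain ⟨J, R, G, P, hA, -⟩ := h
  refine hx0 (him.eq_zero (s := 0) rfl ?_ ?_)
  · rw [zero_smul, zero_sub, neg_mulVec, hA, ← mulVec_mulVec, hx, mulVec_zero, neg_zero]
  · rw [hC, ← mulVec_mulVec, hx, mulVec_zero]

theorem IsPortHamiltonianWith.closedLoop (h : IsPortHamiltonianWith Q E A B C)
    {E' : Matrix (Fin n) (Fin n) ℂ} (hE' : (Qᴴ * E').PosSemidef) :
    IsPortHamiltonianWith Q E' (A - B * C) B C := by
  have hC := h.output_eq
  obtain ⟨J, R, G, P, hA, hB, hC', -, -, hJ, hR, hP⟩ := h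
  -- Since `B C = B Bᴴ Q`, the feedback is absorbed into `R`.
  refine ⟨J, R + B * Bᴴ, G, P, ?_, hB, hC', ?_, hE', hJ, ?_, hP⟩
  · rw [hA, hC, Matrix.sub_mul, Matrix.sub_mul, Matrix.add_mul, Matrix.mul_assoc]
    abel
  · have := hE'.isHermitian.eq
    rw [conjTranspose_mul, conjTranspose_conjTranspose] at this
    exact this.symm
  · have : Qᴴ * (R + B * Bᴴ) * Q = Qᴴ * R * Q + Cᴴ * C := by
      rw [hC, conjTranspose_mul, conjTranspose_conjTranspose]
      simp only [Matrix.mul_add, Matrix.add_mul, Matrix.mul_assoc]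
    rw [this]
    exact hR.add (posSemidef_conjTranspose_mul_self C)

/-- Output feedback `u = -y` dissipates at least the energy `‖C x‖²`. -/
theorem IsPortHamiltonianWith.dissipation (h : IsPortHamiltonianWith Q E A B C) (x : Fin n → ℂ) :
    (star x ⬝ᵥ (Qᴴ * (A - B * C)) *ᵥ x).re ≤ 0 ∧
      ((star x ⬝ᵥ (Qᴴ * (A - B * C)) *ᵥ x).re = 0 → C *ᵥ x = 0) := by
  have hC := h.output_eq
  obtain ⟨J, R, G, P, hA, -, -, -, -, hJ, hR, -⟩ := h
  have hCC := posSemidef_conjTranspose_mul_self C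
  have heq : Qᴴ * (A - B * C) = Qᴴ * J * Q - Qᴴ * R * Q - Cᴴ * C := by
    rw [hA, hC, conjTranspose_mul, conjTranspose_conjTranspose]
    simp only [Matrix.mul_sub, Matrix.sub_mul, Matrix.mul_assoc]
  have hre : (star x ⬝ᵥ (Qᴴ * (A - B * C)) *ᵥ x).re =
      -(star x ⬝ᵥ (Qᴴ * R * Q) *ᵥ x).re - (star x ⬝ᵥ (Cᴴ * C) *ᵥ x).re := by
    rw [heq, sub_mulVec, sub_mulVec, dotProduct_sub, dotProduct_sub, Complex.sub_re, Complex.sub_re,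
      re_star_dotProduct_mulVec_eq_zero_of_skew hJ, zero_sub]
  have h1 : 0 ≤ (star x ⬝ᵥ (Qᴴ * R * Q) *ᵥ x).re := hR.re_dotProduct_nonneg x
  have h2 : 0 ≤ (star x ⬝ᵥ (Cᴴ * C) *ᵥ x).re := hCC.re_dotProduct_nonneg x
  refine ⟨by linarith, fun h0 => ?_⟩
  exact (conjTranspose_mul_self_mulVec_eq_zero C x).1 (hCC.mulVec_eq_zero_of_re (by linarith))

/-- If `E' x = 0` and `A' x = E' y`, then `xᴴ Qᴴ A' x = (Qᴴ E' x)ᴴ y = 0`, so `C x = 0` by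
dissipation. -/
theorem IsPortHamiltonianWith.closedLoop_isImpulseFree (h : IsPortHamiltonianWith Q E A B C)
    (hblock : BlockRankCondition E A B C) (F : Matrix (Fin m) (Fin m) ℂ)
    (hE' : (Qᴴ * (E + B * F * C)).PosSemidef) :
    IsImpulseFree (E + B * F * C) (A - B * C) := by
  rw [isImpulseFree_iff]
  intro x y hx hxy
  rw [blockRankCondition_iff] at hblock
  have h0 : star x ⬝ᵥ (Qᴴ * (A - B * C)) *ᵥ x = 0 := by
    rw [← mulVec_mulVec, hxy, mulVec_mulVec, dotProduct_mulVec, ← hE'.isHermitian.eq,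
      ← star_mulVec, ← mulVec_mulVec, hx, mulVec_zero, star_zero, zero_dotProduct]
  have hC := (h.dissipation x).2 (by rw [h0, Complex.zero_re])
  have hBC : ∀ v, (B * F * C) *ᵥ v = B *ᵥ (F *ᵥ (C *ᵥ v)) := fun v => by
    rw [mulVec_mulVec, mulVec_mulVec, Matrix.mul_assoc]
  refine hblock x (-y) (-(F *ᵥ (C *ᵥ y))) ?_ hC ?_
  · rwa [add_mulVec, hBC, hC, mulVec_zero, mulVec_zero, add_zero] at hx
  · rw [sub_mulVec, ← mulVec_mulVec, hC, mulVec_zero, sub_zero, add_mulVec, hBC] at hxy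
    rw [hxy, mulVec_neg, mulVec_neg]
    abel

theorem IsPortHamiltonianWith.closedLoop_isAsymptoticallyStable
    (h : IsPortHamiltonianWith Q E A B C) (him : ImaginaryAxisRankCondition E A B C)
    (F : Matrix (Fin m) (Fin m) ℂ) (hE' : (Qᴴ * (E + B * F * C)).PosSemidef) :
    IsAsymptoticallyStable (E + B * F * C) (A - B * C) := by
  intro s hs
  by_contra! hre
  obtain ⟨x, hx0, hx⟩ := exists_mulVec_eq_zero_iff.2 hs
  have hBC : ∀ v, (B * F * C) *ᵥ v = B *ᵥ (F *ᵥ (C *ᵥ v)) := fun v => by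
    rw [mulVec_mulVec, mulVec_mulVec, Matrix.mul_assoc]
  have hx' : s • (E + B * F * C) *ᵥ x = (A - B * C) *ᵥ x := by
    rwa [sub_mulVec, smul_mulVec, sub_eq_zero] at hx
  have henergy : s * (star x ⬝ᵥ (Qᴴ * (E + B * F * C)) *ᵥ x) =
      star x ⬝ᵥ (Qᴴ * (A - B * C)) *ᵥ x := by
    rw [← mulVec_mulVec, ← mulVec_mulVec, ← hx', mulVec_smul, dotProduct_smul, smul_eq_mul]
  obtain ⟨he, hei⟩ := Complex.nonneg_iff.1 (hE'.dotProduct_mulVec_nonneg x)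
  have henergy_re := congrArg Complex.re henergy
  rw [Complex.mul_re, ← hei, mul_zero, sub_zero] at henergy_re
  obtain ⟨hd, hd0⟩ := h.dissipation x
  have hprod := mul_nonneg hre he
  -- The energy identity equates a nonnegative and a nonpositive real part, so both vanish.
  have hC := hd0 (by linarith)
  have hE'x : (E + B * F * C) *ᵥ x = E *ᵥ x := by
    rw [add_mulVec, hBC, hC, mulVec_zero, mulVec_zero, add_zero]
  have hA'x : (A - B * C) *ᵥ x = A *ᵥ x := by
    rw [sub_mulVec, ← mulVec_mulVec, hC, mulVec_zero, sub_zero]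
  rw [hA'x, hE'x] at hx'
  rcases hre.eq_or_lt with hs0 | hs0
  · refine hx0 (him.eq_zero hs0.symm ?_ hC)
    rw [sub_mulVec, smul_mulVec, hx', sub_self]
  -- For `Re s > 0` the stored energy vanishes, so `E x = 0` and hence `A x = 0`: the condition at
  -- `s = 0` applies.
  · have he0 : (star x ⬝ᵥ (Qᴴ * (E + B * F * C)) *ᵥ x).re = 0 := by
      have : s.re * (star x ⬝ᵥ (Qᴴ * (E + B * F * C)) *ᵥ x).re = 0 := by linarith
      exact (mul_eq_zero.1 this).resolve_left hs0.ne'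
    have hQE := hE'.mulVec_eq_zero_of_re he0
    have hEx : E *ᵥ x = 0 := by
      rw [← mulVec_mulVec, hE'x] at hQE
      by_contra hne
      have hdet : Qᴴ.det = 0 := exists_mulVec_eq_zero_iff.1 ⟨_, hne, hQE⟩
      rw [det_conjTranspose, star_eq_zero] at hdet
      exact h.det_ne_zero him hdet
    refine hx0 (him.eq_zero (s := 0) rfl ?_ hC)
    rw [zero_smul, zero_sub, neg_mulVec, ← hx', hEx, smul_zero, neg_zero]

theorem IsPortHamiltonianWith.exists_feedback (h : IsPortHamiltonianWith Q E A B C)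
    (hblock : BlockRankCondition E A B C) (him : ImaginaryAxisRankCondition E A B C) (r : ℤ)
    (hr1 : ((fromCols E B).rank : ℤ) - (B.rank : ℤ) ≤ r) (hr2 : r ≤ ((fromCols E B).rank : ℤ)) :
    ∃ K F : Matrix (Fin m) (Fin m) ℂ,
      IsRegular (E + B * F * C) (A - B * K * C) ∧
      IsImpulseFree (E + B * F * C) (A - B * K * C) ∧
      IsAsymptoticallyStable (E + B * F * C) (A - B * K * C) ∧
      ((E + B * F * C).rank : ℤ) = r ∧
      IsPortHamiltonianWith Q (E + B * F * C) (A - B * K * C) B C := by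
  have hE : (Qᴴ * E).PosSemidef := by
    obtain ⟨J, R, G, P, -, -, -, -, hE, -⟩ := h
    exact hE
  have hQ : Qᴴ.det ≠ 0 := by
    rw [det_conjTranspose]
    exact star_ne_zero.2 (h.det_ne_zero him)
  have hrank {l : Type} [Fintype l] (M : Matrix (Fin n) l ℂ) : (Qᴴ * M).rank = M.rank :=
    rank_mul_eq_right_of_det_ne_zero _ _ hQ
  obtain ⟨k, hk⟩ : ∃ k : ℕ, (k : ℤ) = (fromCols E B).rank - r :=
    ⟨_, Int.toNat_of_nonneg (by omega)⟩
  obtain ⟨F, hF, hFr⟩ := hE.exists_add_mul_mul_conjTranspose_rank (Qᴴ * B) k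
    (by rw [hrank]; omega)
  have heq : Qᴴ * E + Qᴴ * B * F * (Qᴴ * B)ᴴ = Qᴴ * (E + B * F * C) := by
    rw [h.output_eq, conjTranspose_mul, conjTranspose_conjTranspose]
    simp only [Matrix.mul_add, Matrix.mul_assoc]
  rw [heq] at hF hFr
  rw [hrank, ← mul_fromCols, hrank] at hFr
  have hstab := h.closedLoop_isAsymptoticallyStable him F hF
  refine ⟨1, F, ?_⟩
  rw [Matrix.mul_one]
  -- Stability excludes the root `0`, which gives regularity.
  exact ⟨⟨0, fun h0 => lt_irrefl _ (hstab 0 h0)⟩, h.closedLoop_isImpulseFree hblock F hF, hstab,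
    by omega, h.closedLoop hF⟩

end PHDescriptor

theorem mainTheorem4 {n m : ℕ} (E A : Matrix (Fin n) (Fin n) ℂ)
    (B : Matrix (Fin n) (Fin m) ℂ) (C : Matrix (Fin m) (Fin n) ℂ)
    (hpH : IsPortHamiltonian E A B C) :
    ((∀ r : ℤ, ((Matrix.fromCols E B).rank : ℤ) - (B.rank : ℤ) ≤ r →
        r ≤ ((Matrix.fromCols E B).rank : ℤ) →
        ∃ K F : Matrix (Fin m) (Fin m) ℂ,
          IsRegular (E + B * F * C) (A - B * K * C) ∧
          IsImpulseFree (E + B * F * C) (A - B * K * C) ∧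
          IsAsymptoticallyStable (E + B * F * C) (A - B * K * C) ∧
          ((E + B * F * C).rank : ℤ) = r ∧
          IsPortHamiltonian (E + B * F * C) (A - B * K * C) B C) ↔
      (BlockRankCondition E A B C ∧ ImaginaryAxisRankCondition E A B C)) ∧
    (∀ Q : Matrix (Fin n) (Fin n) ℂ, IsPortHamiltonianWith Q E A B C →
      ((∀ r : ℤ, ((Matrix.fromCols E B).rank : ℤ) - (B.rank : ℤ) ≤ r →
          r ≤ ((Matrix.fromCols E B).rank : ℤ) →
          ∃ K F : Matrix (Fin m) (Fin m) ℂ,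
            IsRegular (E + B * F * C) (A - B * K * C) ∧
            IsImpulseFree (E + B * F * C) (A - B * K * C) ∧
            IsAsymptoticallyStable (E + B * F * C) (A - B * K * C) ∧
            ((E + B * F * C).rank : ℤ) = r ∧
            IsPortHamiltonianWith Q (E + B * F * C) (A - B * K * C) B C) ↔
        (BlockRankCondition E A B C ∧ ImaginaryAxisRankCondition E A B C))) := by
  -- `S` stands for either port-Hamiltonian requirement, so one argument serves both equivalences.
  have hnec : ∀ S : Matrix (Fin n) (Fin n) ℂ → Matrix (Fin n) (Fin n) ℂ → Prop,
      (∀ r : ℤ, ((Matrix.fromCols E B).rank : ℤ) - (B.rank : ℤ) ≤ r →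
        r ≤ ((Matrix.fromCols E B).rank : ℤ) →
        ∃ K F : Matrix (Fin m) (Fin m) ℂ,
          IsRegular (E + B * F * C) (A - B * K * C) ∧
          IsImpulseFree (E + B * F * C) (A - B * K * C) ∧
          IsAsymptoticallyStable (E + B * F * C) (A - B * K * C) ∧
          ((E + B * F * C).rank : ℤ) = r ∧ S (E + B * F * C) (A - B * K * C)) →
      BlockRankCondition E A B C ∧ ImaginaryAxisRankCondition E A B C := by
    intro S h
    obtain ⟨K, F, -, himp, hstab, hrank, -⟩ := h _ (by omega) le_rfl
    exact ⟨blockRankCondition_of_feedback F K (by exact_mod_cast hrank) himp,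
      imaginaryAxisRankCondition_of_feedback F K hstab⟩
  refine ⟨⟨hnec fun E' A' => IsPortHamiltonian E' A' B C, ?_⟩, fun Q hQ =>
    ⟨hnec fun E' A' => IsPortHamiltonianWith Q E' A' B C, fun h r hr1 hr2 =>
      hQ.exists_feedback h.1 h.2 r hr1 hr2⟩⟩
  rintro ⟨hblock, him⟩ r hr1 hr2
  obtain ⟨Q, hQ⟩ := hpH
  obtain ⟨K, F, h1, h2, h3, h4, h5⟩ := hQ.exists_feedback hblock him r hr1 hr2
  exact ⟨K, F, h1, h2, h3, h4, Q, h5⟩
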